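/- Let $\mathcal Q$ be a smooth $n$-dimensional Riemannian manifold with metric $\langle\cdot,\cdot\rangle$ and a smooth global frame $X_1,\dots,X_n$. A generalized velocity $v\in\mathbb R^n$ at $q$ represents the tangent vector $\dot q=X_i(q)v^i$. Let $H_{ij}=\langle X_i,X_j\rangle$ be the mass matrix, $V:\mathcal Q\to\mathbb R$ a smooth potential, $g_i=\mathcal L_{X_i}V$, and $L(q,v)=\tfrac12 v^\top H(q)v-V(q)$. Let $\overline{\mathcal Q}$ be an $m$-dimensional submanifold of $\mathcal Q$ with inclusion $\iota$, carrying the induced metric, with a smooth global frame $\overline X_1,\dots,\overline X_m$, mass matrix $\overline H_{ij}=\langle\overline X_i,\overline X_j\rangle$ and potential $V\circ\iota$. Define $A(q)\in\mathbb R^{n\times m}$ for $q\in\overline{\mathcal Q}$ by $\overline X_j=A^i_jX_i$, so that $v=A\overline v$, and put $\dot A^i_j=\overline v^k\mathcal L_{\overline X_k}A^i_j$. A Coriolis matrix on $\mathcal Q$ is a matrix $C(q,v)\in\mathbb R^{n\times n}$ that is linear in $v$. It gives the correct dynamics if, along every motion $q(t)$ with generalized velocity $v(t)$, $H\dot v+C(q,v)v+g$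 equals the left-hand side of Hamel's equations, $$\frac{d}{dt}\frac{\partial L}{\partial v^i}+s^k_{ij}\frac{\partial L}{\partial v^k}v^j-\mathcal L_{X_i}L,\qquad [X_i,X_j]=s^k_{ij}X_k ;$$ similarly on $\overline{\mathcal Q}$. Let $C^\star_{ik}(q,v)=\langle X_i,\nabla^\star_{\dot q}X_k\rangle$, where $\nabla^\star$ is the Riemannian (Levi-Civita) connection of $\mathcal Q$, and let $\overline C^\star$ be the corresponding matrix on $\overline{\mathcal Q}$ for the induced metric and the frame $\overline X$. Given a Coriolis matrix $C$ on $\mathcal Q$, define on $\overline{\mathcal Q}$ $$\overline C(q,\overline v)=A^\top C(q,A\overline v)A+A^\top H\dot A .$$ Then: 1. If $C$ gives the correct dynamics on $\mathcal Q$, then $\overline C$ gives the correct dynamics on $\overline{\mathcal Q}$. 2. If $C(q,v)v=C^\star(q,v)v$ for all $q\in\mathcal Q$ and $v\in\mathbb R^n$, then $\overline C(q,\overline v)\,\overline v=\overline C^\star(q,\overline v)\,\overline v$ for all $q\in\overline{\mathcal Q}$ and $\overline v\in\mathbb R^m$, and $\overline C$ gives the correct dynamics on $\overline{\mathcal Q}$.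 -/

import Mathlib

open Bundle
open scoped Manifold ContDiff Bundle Topology Matrix

noncomputable section

namespace Mechanics

/-- A Coriolis matrix: `C q v` is an `n × n` matrix, depending linearly on the generalized
velocity `v`. -/
abbrev CoriolisMatrix (n : ℕ) (Q : Type*) : Type _ :=
  Q → (Fin n → ℝ) →ₗ[ℝ] Matrix (Fin n) (Fin n) ℝ

/-- A smooth global frame `X 0, …, X (n - 1)` of the tangent bundle of an `n`-manifold. -/
abbrev IsFrame {n : ℕ} {Q : Type*} [TopologicalSpace Q]
    [ChartedSpace (EuclideanSpace ℝ (Fin n)) Q] [IsManifold (𝓡 n) ∞ Q]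
    (X : Fin n → (q : Q) → TangentSpace (𝓡 n) q) : Prop :=
  IsLocalFrameOn (𝓡 n) (EuclideanSpace ℝ (Fin n)) ∞ X Set.univ

section Smooth

variable {n : ℕ} {Q : Type*} [TopologicalSpace Q]
  [ChartedSpace (EuclideanSpace ℝ (Fin n)) Q] [IsManifold (𝓡 n) ∞ Q]

/-- The tangent vector `X_i v^i` at `q` with generalized velocity `v`. -/
def velocity (X : Fin n → (q : Q) → TangentSpace (𝓡 n) q) (q : Q) :
    (Fin n → ℝ) →ₗ[ℝ] TangentSpace (𝓡 n) q :=
  Fintype.linearCombination ℝ fun i => X i q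

/-- The structure coefficients `s^k_{ij}`, where `[X_i, X_j] = s^k_{ij} X_k`. -/
def structureCoeff {X : Fin n → (q : Q) → TangentSpace (𝓡 n) q} (hX : IsFrame X) (q : Q)
    (k i j : Fin n) : ℝ :=
  hX.coeff k q (VectorField.mlieBracket (𝓡 n) (X i) (X j) q)

/-- The generalized conservative forces `g_i = 𝓛_{X_i} V` of a potential `V`. -/
def potentialForce (X : Fin n → (q : Q) → TangentSpace (𝓡 n) q) (V : Q → ℝ) (q : Q) :
    Fin n → ℝ :=
  fun i => mvfderiv (𝓡 n) V q (X i q)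

/-- The curve `γ` has generalized velocity `v` at all times near `t`. -/
def HasGeneralizedVelocityNear (X : Fin n → (q : Q) → TangentSpace (𝓡 n) q)
    (γ : ℝ → Q) (v : ℝ → Fin n → ℝ) (t : ℝ) : Prop :=
  ∀ᶠ s in 𝓝 t, HasMFDerivAt 𝓘(ℝ, ℝ) (𝓡 n) γ s
    ((1 : ℝ →L[ℝ] ℝ).smulRight (velocity X (γ s) (v s)))

end Smooth

section Riemannian

variable {n : ℕ} {Q : Type*} [TopologicalSpace Q]
  [ChartedSpace (EuclideanSpace ℝ (Fin n)) Q] [IsManifold (𝓡 n) ∞ Q]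
  [RiemannianBundle (fun q : Q => TangentSpace (𝓡 n) q)]

/-- The mass matrix `H_{ij} = ⟨X_i, X_j⟩` of the kinetic energy metric. -/
def massMatrix (X : Fin n → (q : Q) → TangentSpace (𝓡 n) q) (q : Q) :
    Matrix (Fin n) (Fin n) ℝ :=
  Matrix.of fun i j => inner ℝ (X i q) (X j q)

/-- The Lagrangian `L(q, v) = ½ vᵀ H(q) v - V(q)`. -/
def lagrangian (X : Fin n → (q : Q) → TangentSpace (𝓡 n) q) (V : Q → ℝ) (q : Q)
    (v : Fin n → ℝ) : ℝ :=
  1 / 2 * (v ⬝ᵥ (massMatrix X q *ᵥ v)) - V q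

/-- The generalized momentum `p_k = ∂L/∂v^k`. -/
def momentum (X : Fin n → (q : Q) → TangentSpace (𝓡 n) q) (V : Q → ℝ) (q : Q)
    (v : Fin n → ℝ) : Fin n → ℝ :=
  fun k => fderiv ℝ (lagrangian X V q) v (Pi.single k 1)

/-- The left-hand side of Hamel's equations along a curve `γ` with generalized velocity `v`:
`d/dt (∂L/∂v^i) + s^k_{ij} (∂L/∂v^k) v^j - 𝓛_{X_i} L`. -/
def hamelForce {X : Fin n → (q : Q) → TangentSpace (𝓡 n) q} (hX : IsFrame X) (V : Q → ℝ)
    (γ : ℝ → Q) (v : ℝ → Fin n → ℝ) (t : ℝ) : Fin n → ℝ :=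
  fun i =>
    deriv (fun s => momentum X V (γ s) (v s) i) t
      + ∑ j, ∑ k, structureCoeff hX (γ t) k i j * momentum X V (γ t) (v t) k * v t j
      - mvfderiv (𝓡 n) (fun q => lagrangian X V q (v t)) (γ t) (X i (γ t))

/-- The Coriolis matrix `C` gives the correct dynamics: along every motion, the expression
`H v̇ + C v + g` is the left-hand side of Hamel's equations. -/
def GivesCorrectDynamics {X : Fin n → (q : Q) → TangentSpace (𝓡 n) q} (hX : IsFrame X)
    (V : Q → ℝ) (C : CoriolisMatrix n Q) : Prop :=
  ∀ (γ : ℝ → Q) (v : ℝ → Fin n → ℝ) (t : ℝ),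
    HasGeneralizedVelocityNear X γ v t → DifferentiableAt ℝ v t →
      massMatrix X (γ t) *ᵥ deriv v t + C (γ t) (v t) *ᵥ v t + potentialForce X V (γ t)
        = hamelForce hX V γ v t

/-- An affine connection on `Q`; `D Y q u` is the covariant derivative of `Y` at `q` along `u`. -/
abbrev AffineConnection (n : ℕ) (Q : Type*) [TopologicalSpace Q]
    [ChartedSpace (EuclideanSpace ℝ (Fin n)) Q] [IsManifold (𝓡 n) ∞ Q] : Type _ :=
  CovariantDerivative (𝓡 n) (EuclideanSpace ℝ (Fin n))
    (fun q : Q => TangentSpace (𝓡 n) q)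

/-- The Coriolis matrix `C_{ik}(q, v) = ⟨X_i, ∇_{q̇} X_k⟩`, `q̇ = X_j v^j`, of a connection. -/
def connectionCoriolis (X : Fin n → (q : Q) → TangentSpace (𝓡 n) q)
    (D : AffineConnection n Q) : CoriolisMatrix n Q := fun q =>
  { toFun := fun v => Matrix.of fun i k => inner ℝ (X i q) (D (X k) q (velocity X q v))
    map_add' := fun v w => by
      ext i k
      simp [inner_add_right]
    map_smul' := fun a v => by
      ext i k
      simp [inner_smul_right] }

set_option synthInstance.maxHeartbeats 200000 in
/-- `D` is the Riemannian (Levi-Civita) connection: torsion free and compatible with the metric. -/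
def IsRiemannianConnection
    [IsContMDiffRiemannianBundle (𝓡 n) ∞ (EuclideanSpace ℝ (Fin n))
      (fun q : Q => TangentSpace (𝓡 n) q)]
    (D : AffineConnection n Q) : Prop :=
  D.torsion = 0 ∧ D.IsMetricCompatible

end Riemannian

section Submanifold

variable {n m : ℕ}
  {Q : Type*} [TopologicalSpace Q] [ChartedSpace (EuclideanSpace ℝ (Fin n)) Q]
  [IsManifold (𝓡 n) ∞ Q]
  {Q' : Type*} [TopologicalSpace Q'] [ChartedSpace (EuclideanSpace ℝ (Fin m)) Q']
  [IsManifold (𝓡 m) ∞ Q']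

/-- The matrix `A` of coefficients in `X'_j = A^i_j X_i` (tangent vectors of `Q'` are viewed
in `Q` through the differential of `ι`). -/
def transformMatrix {X : Fin n → (q : Q) → TangentSpace (𝓡 n) q} (hX : IsFrame X)
    (X' : Fin m → (q : Q') → TangentSpace (𝓡 m) q) (ι : Q' → Q) (q : Q') :
    Matrix (Fin n) (Fin m) ℝ :=
  Matrix.of fun i j => hX.coeff i (ι q) (mfderiv (𝓡 m) (𝓡 n) ι q (X' j q))

/-- The matrix `Ȧ`, with entries `Ȧ^i_j = v^k 𝓛_{X'_k} A^i_j`. -/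
def transformMatrixDot {X : Fin n → (q : Q) → TangentSpace (𝓡 n) q} (hX : IsFrame X)
    (X' : Fin m → (q : Q') → TangentSpace (𝓡 m) q) (ι : Q' → Q) (q : Q') :
    (Fin m → ℝ) →ₗ[ℝ] Matrix (Fin n) (Fin m) ℝ where
  toFun v := Matrix.of fun i j => ∑ k, v k *
    mvfderiv (𝓡 m) (fun r => transformMatrix hX X' ι r i j) q (X' k q)
  map_add' v w := by
    ext i j
    simp [add_mul, Finset.sum_add_distrib]
  map_smul' a v := by
    ext i j
    simp [mul_assoc, Finset.mul_sum]

/-- The transformation law: `C'(q, v') = Aᵀ C(q, A v') A + Aᵀ H Ȧ`. -/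
def inducedCoriolis [RiemannianBundle (fun q : Q => TangentSpace (𝓡 n) q)]
    {X : Fin n → (q : Q) → TangentSpace (𝓡 n) q} (hX : IsFrame X)
    (X' : Fin m → (q : Q') → TangentSpace (𝓡 m) q) (ι : Q' → Q) (C : CoriolisMatrix n Q) :
    CoriolisMatrix m Q' := fun q =>
  let A := transformMatrix hX X' ι q
  { toFun := fun v => Aᵀ * C (ι q) (A *ᵥ v) * A
      + Aᵀ * massMatrix X (ι q) * transformMatrixDot hX X' ι q v
    map_add' := fun v w => by
      simp only [Matrix.mulVec_add, map_add, Matrix.mul_add, Matrix.add_mul]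
      abel
    map_smul' := fun a v => by
      simp [Matrix.mulVec_smul] }

end Submanifold

end Mechanics

end

/-! Along any motion the left-hand side of Hamel's equations splits as `H v̇ + F(q, v) + g`, with
`F` = `quadraticForce` quadratic in `v` and built from derivatives of `H` and inner products of
brackets with frame fields (`hamelForce_eq`). Correct dynamics therefore means `C v = F` along
motions. For the Levi-Civita connection, metric compatibility and vanishing torsion give `C⋆ v = F`,
a contracted Koszul formula (`connectionCoriolis_mulVec_eq_quadraticForce`).

Everything then rests on the transformation law `F'(v) = Aᵀ F(A v) + Aᵀ H Ȧ v`
(`quadraticForce_induced`), which has the same shape as the definition of the induced Coriolis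
matrix. It follows by differentiating `H' = Aᵀ H A` and expanding the pushed-forward brackets of
`X'` in the frame `X` (`mfderiv_mlieBracket_frame`). All terms with derivatives of `A`, except `Aᵀ H
Ȧ v`, are antisymmetric in the two velocity indices and cancel. Of `ι` only smoothness and the
isometry condition enter. -/

noncomputable section

/-! ### Lie brackets as commutators of derivations, computed in a chart. -/

section LieBracketDerivation

open VectorField

variable {E : Type*} [NormedAddCommGroup E] [NormedSpace ℝ E]
  {H : Type*} [TopologicalSpace H] {I : ModelWithCorners ℝ E H}
  {M : Type*} [TopologicalSpace M] [ChartedSpace H M]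
  {F : Type*} [NormedAddCommGroup F] [NormedSpace ℝ F]

theorem HasFDerivAt.hasMFDerivAt_of_comp_extChartAt_symm [IsManifold I 1 M] {h : M → F} {x : M}
    {L : E →L[ℝ] F} (hL : HasFDerivAt (h ∘ (extChartAt I x).symm) L (extChartAt I x x)) :
    HasMFDerivAt I 𝓘(ℝ, F) h x (L ∘L mvfderiv I (extChartAt I x) x) := by
  have h1 := hL.hasMFDerivAt.comp x
    (mdifferentiableAt_extChartAt (I := I) (ChartedSpace.mem_chart_source x)).hasMFDerivAt
  refine h1.congr_of_eventuallyEq ?_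
  filter_upwards [extChartAt_source_mem_nhds (I := I) x] with y hy
  rw [Function.comp_apply, Function.comp_apply, (extChartAt I x).left_inv hy]

theorem HasFDerivAt.mvfderiv_apply_of_comp_extChartAt_symm [IsManifold I 1 M] {h : M → F} {x : M}
    {L : E →L[ℝ] F} (hL : HasFDerivAt (h ∘ (extChartAt I x).symm) L (extChartAt I x x))
    (u : TangentSpace I x) :
    mvfderiv I h x u = L (mvfderiv I (extChartAt I x) x u) :=
  congrArg (fun T : TangentSpace I x →L[ℝ] F => T u)
    hL.hasMFDerivAt_of_comp_extChartAt_symm.mfderiv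

theorem isInvertible_mvfderiv_extChartAt [IsManifold I 1 M] (x : M) :
    (mvfderiv I (extChartAt I x) x).IsInvertible :=
  isInvertible_mfderiv_extChartAt (I := I) (mem_extChartAt_source (I := I) x)

/-- The vector field `V` read in the extended chart at `x`. -/
def chartVectorField (V : (y : M) → TangentSpace I y) (x : M) : E → E :=
  mpullback 𝓘(ℝ, E) I (extChartAt I x).symm V

variable [I.Boundaryless]

theorem ContMDiffAt.contDiffAt_comp_extChartAt_symm {f : M → F} {x : M} {k : ℕ∞ω}
    (hf : ContMDiffAt I 𝓘(ℝ, F) k f x) :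
    ContDiffAt ℝ k (f ∘ (extChartAt I x).symm) (extChartAt I x x) := by
  have := contMDiffAt_iff_source.1 hf
  rw [I.range_eq_univ, contMDiffWithinAt_univ] at this
  exact this.contDiffAt

theorem MDifferentiableAt.mvfderiv_apply_eq_fderiv [IsManifold I 1 M] {f : M → F} {x : M}
    (hf : MDifferentiableAt I 𝓘(ℝ, F) f x) (u : TangentSpace I x) :
    mvfderiv I f x u = fderiv ℝ (f ∘ (extChartAt I x).symm) (extChartAt I x x)
      (mvfderiv I (extChartAt I x) x u) := by
  have hd : DifferentiableAt ℝ (f ∘ (extChartAt I x).symm) (extChartAt I x x) := by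
    have := hf.differentiableWithinAt_writtenInExtChartAt
    rwa [I.range_eq_univ, differentiableWithinAt_univ] at this
  exact hd.hasFDerivAt.mvfderiv_apply_of_comp_extChartAt_symm u

theorem mlieBracket_eq_inverse_lieBracket (V W : (y : M) → TangentSpace I y) (x : M) :
    mlieBracket I V W x = (mvfderiv I (extChartAt I x) x).inverse
      (lieBracket ℝ (chartVectorField V x) (chartVectorField W x) (extChartAt I x x)) := by
  rw [← mlieBracketWithin_univ, mlieBracketWithin_apply, Set.preimage_univ, Set.univ_inter,
    I.range_eq_univ, mpullbackWithin_univ, mpullbackWithin_univ, ← lieBracketWithin_univ]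
  rfl

variable [IsManifold I 2 M]

/-- The chart formula for `V f` is needed on a neighbourhood, because it is differentiated once more
below. -/
theorem eventually_mvfderiv_apply_eq_fderiv {f : M → F} {x : M}
    (hf : ContMDiffAt I 𝓘(ℝ, F) 2 f x) (V : (y : M) → TangentSpace I y) :
    ∀ᶠ y in 𝓝 (extChartAt I x x),
      mvfderiv I f ((extChartAt I x).symm y) (V ((extChartAt I x).symm y)) =
        fderiv ℝ (f ∘ (extChartAt I x).symm) y (chartVectorField V x y) := by
  have : IsManifold I 1 M := IsManifold.of_le (n := 2) (by norm_num)
  have h1 : ∀ᶠ y in 𝓝 x, ContMDiffAt I 𝓘(ℝ, F) 2 f y :=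
    (contMDiffAt_iff_contMDiffAt_nhds (by simp)).1 hf
  have h2 : ∀ᶠ y in 𝓝 (extChartAt I x x),
      ContMDiffAt I 𝓘(ℝ, F) 2 f ((extChartAt I x).symm y) := by
    have hc := continuousAt_extChartAt_symm (I := I) x
    rw [ContinuousAt, extChartAt_to_inv] at hc
    exact hc.eventually h1
  filter_upwards [h2, extChartAt_target_mem_nhds (I := I) x] with y hy hyt
  have hfy : MDifferentiableAt I 𝓘(ℝ, F) f ((extChartAt I x).symm y) :=
    hy.mdifferentiableAt (by simp)
  have hsy := mdifferentiableWithinAt_extChartAt_symm (I := I) hyt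
  have hinv := isInvertible_mfderivWithin_extChartAt_symm (I := I) hyt
  rw [I.range_eq_univ, mdifferentiableWithinAt_univ] at hsy
  rw [I.range_eq_univ, mfderivWithin_univ] at hinv
  rw [← mfderiv_eq_fderiv, mfderiv_comp y hfy hsy]
  exact congrArg (mvfderiv I f ((extChartAt I x).symm y))
    (hinv.self_apply_inverse (V ((extChartAt I x).symm y))).symm

theorem mvfderiv_extChartAt_apply_eq_chartVectorField (x : M) (V : (y : M) → TangentSpace I y) :
    mvfderiv I (extChartAt I x) x (V x) = chartVectorField V x (extChartAt I x x) := by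
  have : IsManifold I 1 M := IsManifold.of_le (n := 2) (by norm_num)
  have h := mfderiv_extChartAt_inverse_comp_mfderivWithin_extChartAT_symm (I := I) (V x)
  have h' := ((isInvertible_mvfderiv_extChartAt (I := I) x).inverse_apply_eq).1 h
  -- `V x` and `V ((extChartAt I x).symm (extChartAt I x x))` lie in different fibres; both are read
  -- in the model space `E` so that they can be compared.
  have hV : ∀ z, x = z → (show E from V x) = (show E from V z) := by
    rintro _ rfl
    rfl
  rw [← h', I.range_eq_univ, mfderivWithin_univ]
  exact congrArg (fun w : E => (show E →L[ℝ] E from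
    (mfderiv 𝓘(ℝ, E) I (extChartAt I x).symm (extChartAt I x x)).inverse) w)
    (hV _ (extChartAt_to_inv x).symm)

variable [CompleteSpace E]

theorem MDifferentiableAt.differentiableAt_chartVectorField {V : (y : M) → TangentSpace I y} {x : M}
    (hV : MDifferentiableAt I I.tangent (fun y => (⟨y, V y⟩ : TangentBundle I M)) x) :
    DifferentiableAt ℝ (chartVectorField V x) (extChartAt I x x) := by
  have := MDifferentiableWithinAt.differentiableWithinAt_mpullbackWithin_vectorField
    (s := Set.univ) (V := V) hV.mdifferentiableWithinAt
  rw [Set.preimage_univ, Set.univ_inter, I.range_eq_univ, mpullbackWithin_univ] at this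
  exact differentiableWithinAt_univ.1 this

/-- Product rule for `y ↦ Df(y) V(y)` in the chart: one term differentiates the field, the other is
the second derivative of `f`. -/
theorem ContMDiffAt.hasFDerivAt_mvfderiv_apply_comp_extChartAt_symm {f : M → F} {x : M}
    (hf : ContMDiffAt I 𝓘(ℝ, F) 2 f x) {V : (y : M) → TangentSpace I y}
    (hV : MDifferentiableAt I I.tangent (fun y => (⟨y, V y⟩ : TangentBundle I M)) x) :
    HasFDerivAt ((fun y => mvfderiv I f y (V y)) ∘ (extChartAt I x).symm)
      ((fderiv ℝ (f ∘ (extChartAt I x).symm) (extChartAt I x x)).comp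
        (fderiv ℝ (chartVectorField V x) (extChartAt I x x)) +
        (fderiv ℝ (fderiv ℝ (f ∘ (extChartAt I x).symm)) (extChartAt I x x)).flip
          (chartVectorField V x (extChartAt I x x))) (extChartAt I x x) := by
  have hd : DifferentiableAt ℝ (fderiv ℝ (f ∘ (extChartAt I x).symm)) (extChartAt I x x) :=
    (hf.contDiffAt_comp_extChartAt_symm.fderiv_right (m := 1) (by norm_num)).differentiableAt
      (by simp)
  exact (hd.hasFDerivAt.clm_apply
    hV.differentiableAt_chartVectorField.hasFDerivAt).congr_of_eventuallyEq
      (eventually_mvfderiv_apply_eq_fderiv hf V)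

theorem ContMDiffAt.mdifferentiableAt_mvfderiv_apply {f : M → F} {x : M}
    (hf : ContMDiffAt I 𝓘(ℝ, F) 2 f x) {V : (y : M) → TangentSpace I y}
    (hV : MDifferentiableAt I I.tangent (fun y => (⟨y, V y⟩ : TangentBundle I M)) x) :
    MDifferentiableAt I 𝓘(ℝ, F) (fun y => mvfderiv I f y (V y)) x := by
  have : IsManifold I 1 M := IsManifold.of_le (n := 2) (by norm_num)
  exact (hf.hasFDerivAt_mvfderiv_apply_comp_extChartAt_symm
    hV).hasMFDerivAt_of_comp_extChartAt_symm.mdifferentiableAt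

/-- Vector fields act on functions by derivations, with `[V, W] f = V (W f) - W (V f)`. -/
theorem ContMDiffAt.mvfderiv_mlieBracket {f : M → F} {x : M} (hf : ContMDiffAt I 𝓘(ℝ, F) 2 f x)
    {V W : (y : M) → TangentSpace I y}
    (hV : MDifferentiableAt I I.tangent (fun y => (⟨y, V y⟩ : TangentBundle I M)) x)
    (hW : MDifferentiableAt I I.tangent (fun y => (⟨y, W y⟩ : TangentBundle I M)) x) :
    mvfderiv I f x (mlieBracket I V W x) =
      mvfderiv I (fun y => mvfderiv I f y (W y)) x (V x) -
        mvfderiv I (fun y => mvfderiv I f y (V y)) x (W x) := by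
  have : IsManifold I 1 M := IsManifold.of_le (n := 2) (by norm_num)
  -- Symmetry of the second derivative cancels the Hessian terms of `V (W f) - W (V f)`, leaving the
  -- chart bracket.
  have hsymm := hf.contDiffAt_comp_extChartAt_symm.isSymmSndFDerivAt (by simp)
  rw [(hf.hasFDerivAt_mvfderiv_apply_comp_extChartAt_symm
      hW).mvfderiv_apply_of_comp_extChartAt_symm,
    (hf.hasFDerivAt_mvfderiv_apply_comp_extChartAt_symm
      hV).mvfderiv_apply_of_comp_extChartAt_symm,
    (hf.mdifferentiableAt (by simp)).mvfderiv_apply_eq_fderiv,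
    mlieBracket_eq_inverse_lieBracket, (isInvertible_mvfderiv_extChartAt x).self_apply_inverse]
  simp only [ContinuousLinearMap.comp_apply, mvfderiv_extChartAt_apply_eq_chartVectorField,
    _root_.add_apply, ContinuousLinearMap.flip_apply, lieBracket, map_sub]
  rw [hsymm.eq]
  abel

end LieBracketDerivation

/-! ### Derivatives along curves, and differentiability of solutions of linear systems. -/

section CurveCalculus

variable {E : Type*} [NormedAddCommGroup E] [NormedSpace ℝ E]
  {H : Type*} [TopologicalSpace H] {I : ModelWithCorners ℝ E H}
  {M : Type*} [TopologicalSpace M] [ChartedSpace H M]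
  {F : Type*} [NormedAddCommGroup F] [NormedSpace ℝ F]

theorem MDifferentiableAt.hasDerivAt_comp_curve {h : M → F} {γ : ℝ → M} {t : ℝ}
    {u : TangentSpace I (γ t)} (hh : MDifferentiableAt I 𝓘(ℝ, F) h (γ t))
    (hγ : HasMFDerivAt 𝓘(ℝ, ℝ) I γ t ((1 : ℝ →L[ℝ] ℝ).smulRight u)) :
    HasDerivAt (fun s => h (γ s)) (mvfderiv I h (γ t) u) t := by
  have h1 : HasFDerivAt (h ∘ γ) (mvfderiv I h (γ t) ∘L (1 : ℝ →L[ℝ] ℝ).smulRight u) t :=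
    (hh.hasMFDerivAt.comp t hγ).hasFDerivAt
  refine h1.hasDerivAt.congr_deriv ?_
  exact congrArg (mvfderiv I h (γ t)) (one_smul ℝ u)

/-- The straight line in the chart at `x`, with velocity `u` at time `0`. -/
def chartLine (x : M) (u : TangentSpace I x) (s : ℝ) : M :=
  (extChartAt I x).symm (extChartAt I x x + s • mvfderiv I (extChartAt I x) x u)

theorem chartLine_zero (x : M) (u : TangentSpace I x) : chartLine x u 0 = x := by
  simp [chartLine]

theorem tendsto_chartLine (x : M) (u : TangentSpace I x) :
    Filter.Tendsto (chartLine x u) (𝓝 0) (𝓝 x) := by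
  have h1 := continuousAt_extChartAt_symm (I := I) x
  rw [ContinuousAt, extChartAt_to_inv] at h1
  have h2 : Filter.Tendsto
      (fun s : ℝ => extChartAt I x x + s • mvfderiv I (extChartAt I x) x u) (𝓝 0)
      (𝓝 (extChartAt I x x)) := by
    have : Continuous (fun s : ℝ => extChartAt I x x + s • mvfderiv I (extChartAt I x) x u) := by
      fun_prop
    simpa using this.tendsto 0
  exact h1.comp h2

/-- Turns a directional derivative on the manifold into an ordinary derivative, so that sum and
product rules in one variable apply and results are compared by uniqueness. -/
theorem MDifferentiableAt.hasDerivAt_comp_chartLine [IsManifold I 1 M] [I.Boundaryless]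
    {h : M → F} {x : M} (hh : MDifferentiableAt I 𝓘(ℝ, F) h x) (u : TangentSpace I x) :
    HasDerivAt (fun s => h (chartLine x u s)) (mvfderiv I h x u) 0 := by
  have hd : DifferentiableAt ℝ (h ∘ (extChartAt I x).symm) (extChartAt I x x) := by
    have := hh.differentiableWithinAt_writtenInExtChartAt
    rwa [I.range_eq_univ, differentiableWithinAt_univ] at this
  rw [hh.mvfderiv_apply_eq_fderiv]
  have hl : HasDerivAt (fun s : ℝ => extChartAt I x x + s • mvfderiv I (extChartAt I x) x u)
      (mvfderiv I (extChartAt I x) x u) 0 := by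
    simpa using ((hasDerivAt_id (0 : ℝ)).smul_const
      (mvfderiv I (extChartAt I x) x u)).const_add (extChartAt I x x)
  exact HasFDerivAt.comp_hasDerivAt_of_eq 0 hd.hasFDerivAt hl (by simp)

theorem mdifferentiableAt_pi {ι : Type*} [Fintype ι] {f : M → ι → F} {x : M}
    (hf : ∀ i, MDifferentiableAt I 𝓘(ℝ, F) (fun y => f y i) x) :
    MDifferentiableAt I 𝓘(ℝ, ι → F) f x :=
  (mdifferentiableAt_iff f x).2 ⟨continuousAt_pi.2 fun i => (hf i).continuousAt,
    differentiableWithinAt_pi.2 fun i => ((mdifferentiableAt_iff _ x).1 (hf i)).2⟩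

theorem mdifferentiableAt_matrix_det {n : ℕ} {N : M → Matrix (Fin n) (Fin n) ℝ} {x : M}
    (hN : ∀ i j, MDifferentiableAt I 𝓘(ℝ, ℝ) (fun y => N y i j) x) :
    MDifferentiableAt I 𝓘(ℝ, ℝ) (fun y => (N y).det) x := by
  have h1 : MDifferentiableAt I 𝓘(ℝ, Fin n × Fin n → ℝ) 
      (fun (y : M) (p : Fin n × Fin n) => N y p.1 p.2) x :=
    mdifferentiableAt_pi fun p => hN p.1 p.2
  have h2 : Differentiable ℝ (fun T : Fin n × Fin n → ℝ =>
      (Matrix.of fun i j => T (i, j)).det) := by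
    simp only [Matrix.det_apply, Matrix.of_apply]
    fun_prop
  exact h2.differentiableAt.comp_mdifferentiableAt h1

theorem mdifferentiableAt_matrix_adjugate {n : ℕ} {N : M → Matrix (Fin n) (Fin n) ℝ} {x : M}
    (hN : ∀ i j, MDifferentiableAt I 𝓘(ℝ, ℝ) (fun y => N y i j) x) (i j : Fin n) :
    MDifferentiableAt I 𝓘(ℝ, ℝ) (fun y => (N y).adjugate i j) x := by
  simp only [Matrix.adjugate_apply]
  refine mdifferentiableAt_matrix_det fun a b => ?_
  by_cases h : a = j
  · subst h
    simpa using mdifferentiableAt_const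
  · simpa [Matrix.updateRow_ne h] using hN a b

/-- Cramer's rule: `c = (det N)⁻¹ adj(N) g` is rational in differentiable data. -/
theorem mdifferentiableAt_of_mulVec {n : ℕ} {N : M → Matrix (Fin n) (Fin n) ℝ}
    {c g : M → Fin n → ℝ} {x : M}
    (hN : ∀ i j, MDifferentiableAt I 𝓘(ℝ, ℝ) (fun y => N y i j) x)
    (hg : ∀ i, MDifferentiableAt I 𝓘(ℝ, ℝ) (fun y => g y i) x)
    (hdet : ∀ y, (N y).det ≠ 0) (hc : ∀ y, N y *ᵥ c y = g y) (i : Fin n) :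
    MDifferentiableAt I 𝓘(ℝ, ℝ) (fun y => c y i) x := by
  have h1 : ∀ y, c y i = (N y).det⁻¹ * ∑ j, (N y).adjugate i j * g y j := fun y => by
    have h2 : (N y).det • c y = (N y).adjugate *ᵥ g y := by
      rw [← hc, Matrix.mulVec_mulVec, Matrix.adjugate_mul, Matrix.smul_mulVec, Matrix.one_mulVec]
    have h3 := congrFun h2 i
    rw [Pi.smul_apply, smul_eq_mul] at h3
    rw [eq_inv_mul_iff_mul_eq₀ (hdet y), h3]
    rfl
  have h2 : MDifferentiableAt I 𝓘(ℝ, ℝ × (Fin n → ℝ × ℝ))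
      (fun y => ((N y).det, fun j => ((N y).adjugate i j, g y j))) x := by
    exact (mdifferentiableAt_matrix_det hN).prodMk_space (mdifferentiableAt_pi fun j =>
      (mdifferentiableAt_matrix_adjugate hN i j).prodMk_space (hg j))
  simp only [h1]
  have h3 : DifferentiableAt ℝ (fun p : ℝ × (Fin n → ℝ × ℝ) => p.1⁻¹ * ∑ j, (p.2 j).1 * (p.2 j).2)
      ((N x).det, fun j => ((N x).adjugate i j, g x j)) := by
    have := hdet x
    fun_prop (disch := assumption)
  exact DifferentiableAt.comp_mdifferentiableAt
    (f := fun y => ((N y).det, fun j => ((N y).adjugate i j, g y j))) h3 h2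

end CurveCalculus

/-! ### The mass matrix as Gram matrix of the frame. -/

namespace Mechanics

variable {n : ℕ} {Q : Type*} [TopologicalSpace Q]
  [ChartedSpace (EuclideanSpace ℝ (Fin n)) Q]

variable [RiemannianBundle (fun q : Q => TangentSpace (𝓡 n) q)]

theorem massMatrix_symm (X : Fin n → (q : Q) → TangentSpace (𝓡 n) q) (q : Q) (i j : Fin n) :
    massMatrix X q i j = massMatrix X q j i :=
  real_inner_comm (X j q) (X i q)

theorem inner_velocity (X : Fin n → (q : Q) → TangentSpace (𝓡 n) q) (q : Q) (i : Fin n)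
    (v : Fin n → ℝ) : inner ℝ (X i q) (velocity X q v) = (massMatrix X q *ᵥ v) i := by
  simp [velocity, Fintype.linearCombination_apply, inner_sum, inner_smul_right, Matrix.mulVec,
    dotProduct, massMatrix, mul_comm]

variable [IsManifold (𝓡 n) ∞ Q]

/-- A kernel vector `v` has `|X_i v^i|² = vᵀ H v = 0`, so `v = 0` by independence of the frame. -/
theorem IsFrame.det_massMatrix_ne_zero {X : Fin n → (q : Q) → TangentSpace (𝓡 n) q}
    (hX : IsFrame X) (q : Q) : (massMatrix X q).det ≠ 0 := by
  intro h
  obtain ⟨v, hv, hv0⟩ := Matrix.exists_mulVec_eq_zero_iff.2 h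
  apply hv
  have h1 : inner ℝ (velocity X q v) (velocity X q v) = (0 : ℝ) := by
    conv_lhs =>
      arg 2
      rw [velocity, Fintype.linearCombination_apply]
    simp [sum_inner, inner_smul_left, inner_velocity, hv0]
  have h2 := inner_self_eq_zero.1 h1
  have := Fintype.linearIndependent_iff.1 (hX.linearIndependent (Set.mem_univ q)) v h2
  exact funext this

omit [RiemannianBundle (fun q : Q => TangentSpace (𝓡 n) q)] in
theorem IsFrame.mdifferentiableAt {X : Fin n → (q : Q) → TangentSpace (𝓡 n) q} (hX : IsFrame X)
    (i : Fin n) (q : Q) :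
    MDifferentiableAt (𝓡 n) (𝓡 n).tangent (fun r => (⟨r, X i r⟩ : TangentBundle (𝓡 n) Q)) q :=
  (hX.contMDiffAt isOpen_univ (Set.mem_univ q) i).mdifferentiableAt (by simp)

end Mechanics

/-! ### The transition matrix `A` and the brackets of the two frames. -/

namespace Mechanics

variable {n m : ℕ} {Q : Type*} [TopologicalSpace Q]
  [ChartedSpace (EuclideanSpace ℝ (Fin n)) Q] [IsManifold (𝓡 n) ∞ Q]
  {X : Fin n → (q : Q) → TangentSpace (𝓡 n) q}

theorem IsFrame.sum_coeff_smul (hX : IsFrame X) (q : Q) (u : TangentSpace (𝓡 n) q) :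
    ∑ i, hX.coeff i q u • X i q = u := by
  -- The frame expansion is stated for sections, so the single vector `u` is first extended to one.
  have := hX.coeff_sum_eq (FiberBundle.extend (EuclideanSpace ℝ (Fin n)) u) (Set.mem_univ q)
  simpa using this.symm

variable {Q' : Type*} [TopologicalSpace Q'] [ChartedSpace (EuclideanSpace ℝ (Fin m)) Q']
  [IsManifold (𝓡 m) ∞ Q'] {X' : Fin m → (q : Q') → TangentSpace (𝓡 m) q} {ι : Q' → Q}

omit [IsManifold (𝓡 m) ∞ Q'] in
theorem sum_transformMatrix_smul (hX : IsFrame X)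
    (X' : Fin m → (q : Q') → TangentSpace (𝓡 m) q) (ι : Q' → Q) (q : Q') (j : Fin m) :
    ∑ i, transformMatrix hX X' ι q i j • X i (ι q) = mfderiv (𝓡 m) (𝓡 n) ι q (X' j q) :=
  hX.sum_coeff_smul (ι q) (mfderiv (𝓡 m) (𝓡 n) ι q (X' j q))

omit [IsManifold (𝓡 m) ∞ Q'] in
theorem velocity_transformMatrix_mulVec (hX : IsFrame X)
    (X' : Fin m → (q : Q') → TangentSpace (𝓡 m) q) (ι : Q' → Q) (q : Q') (v : Fin m → ℝ) :
    velocity X (ι q) (transformMatrix hX X' ι q *ᵥ v) =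
      mfderiv (𝓡 m) (𝓡 n) ι q (velocity X' q v) := by
  simp only [velocity, Fintype.linearCombination_apply, map_sum, map_smul,
    ← sum_transformMatrix_smul hX X' ι q, Finset.smul_sum, Matrix.mulVec, dotProduct,
    Finset.sum_smul, smul_smul]
  rw [Finset.sum_comm]
  simp only [mul_comm]

theorem IsFrame.mdifferentiableAt_mfderiv_apply (hι : ContMDiff (𝓡 m) (𝓡 n) ∞ ι) (hX' : IsFrame X')
    (j : Fin m) (q : Q') :
    MDifferentiableAt (𝓡 m) (𝓡 n).tangent
      (fun r => (⟨ι r, mfderiv (𝓡 m) (𝓡 n) ι r (X' j r)⟩ : TangentBundle (𝓡 n) Q)) q :=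
  MDifferentiableAt.comp q
    ((hι.contMDiff_tangentMap (m := 1)
      (by rw [one_add_one_eq_two]; exact WithTop.coe_le_coe.2 (le_top : (2 : ℕ∞) ≤ ⊤))).mdifferentiable
      (by simp) ⟨q, X' j q⟩) (hX'.mdifferentiableAt j q)

section Riemannian

variable [RiemannianBundle (fun q : Q => TangentSpace (𝓡 n) q)]
  [IsContMDiffRiemannianBundle (𝓡 n) ∞ (EuclideanSpace ℝ (Fin n))
      (fun q : Q => TangentSpace (𝓡 n) q)]

instance isContMDiffRiemannianBundle_one :
    IsContMDiffRiemannianBundle (𝓡 n) 1 (EuclideanSpace ℝ (Fin n))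
      (fun q : Q => TangentSpace (𝓡 n) q) :=
  IsContMDiffRiemannianBundle.of_le (n := ∞) (by exact_mod_cast le_top)

theorem IsFrame.mdifferentiableAt_massMatrix (hX : IsFrame X) (i j : Fin n) (q : Q) :
    MDifferentiableAt (𝓡 n) 𝓘(ℝ, ℝ) (fun r => massMatrix X r i j) q :=
  MDifferentiableAt.inner_bundle (hX.mdifferentiableAt i q) (hX.mdifferentiableAt j q)

/-- Pairing `X'_j = A^i_j X_i` with the frame `X` shows that each column of `A` solves a linear
system whose matrix is the invertible `H ∘ ι` and whose right-hand side is differentiable. -/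
theorem mdifferentiableAt_transformMatrix (hι : ContMDiff (𝓡 m) (𝓡 n) ∞ ι) (hX : IsFrame X)
    (hX' : IsFrame X') (i : Fin n) (j : Fin m) (q : Q') :
    MDifferentiableAt (𝓡 m) 𝓘(ℝ, ℝ) (fun r => transformMatrix hX X' ι r i j) q := by
  have hιq := (hι.mdifferentiable (by simp)) q
  refine mdifferentiableAt_of_mulVec (N := fun r => massMatrix X (ι r))
    (c := fun r i => transformMatrix hX X' ι r i j)
    (g := fun r i => inner ℝ (X i (ι r)) (mfderiv (𝓡 m) (𝓡 n) ι r (X' j r)))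
    (fun a b => (hX.mdifferentiableAt_massMatrix a b (ι q)).comp q hιq) (fun a => ?_)
    (fun r => hX.det_massMatrix_ne_zero (ι r)) (fun r => ?_) i
  · exact MDifferentiableAt.inner_bundle ((hX.mdifferentiableAt a (ι q)).comp q hιq)
      (hX'.mdifferentiableAt_mfderiv_apply hι j q)
  · ext a
    rw [← inner_velocity, velocity, Fintype.linearCombination_apply, sum_transformMatrix_smul]

open VectorField in
/-- The frames `X'` of the submanifold and `X` are related by `A`; this is the induced relation
between their brackets. -/
theorem mfderiv_mlieBracket_frame (hι : ContMDiff (𝓡 m) (𝓡 n) ∞ ι) (hX : IsFrame X)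
    (hX' : IsFrame X') (i j : Fin m) (q : Q') :
    mfderiv (𝓡 m) (𝓡 n) ι q (mlieBracket (𝓡 m) (X' i) (X' j) q) =
      ∑ a, (mvfderiv (𝓡 m) (fun r => transformMatrix hX X' ι r a j) q (X' i q)
          - mvfderiv (𝓡 m) (fun r => transformMatrix hX X' ι r a i) q (X' j q)) • X a (ι q)
        + ∑ a, ∑ b, (transformMatrix hX X' ι q a i * transformMatrix hX X' ι q b j) •
          mlieBracket (𝓡 n) (X a) (X b) (ι q) := by
  -- The chart serves as a vector-valued test function: its differential at `ι q` is injective, so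
  -- both sides may be compared as derivations acting on `φ`.
  set φ := extChartAt (𝓡 n) (ι q) with hφ
  have hφs : ContMDiffAt (𝓡 n) 𝓘(ℝ, EuclideanSpace ℝ (Fin n)) 2 φ (ι q) :=
    contMDiffAt_extChartAt
  have hιq : ContMDiffAt (𝓡 m) (𝓡 n) 2 ι q := (hι q).of_le
    (WithTop.coe_le_coe.2 (le_top : (2 : ℕ∞) ≤ ⊤))
  have hιd (r : Q') : MDifferentiableAt (𝓡 m) (𝓡 n) ι r := (hι.mdifferentiable (by simp)) r
  have hk : ContMDiffAt (𝓡 m) 𝓘(ℝ, EuclideanSpace ℝ (Fin n)) 2 (φ ∘ ι) q := hφs.comp q hιq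
  have hinj : Function.Injective (mvfderiv (𝓡 n) φ (ι q)) :=
    (isInvertible_mvfderiv_extChartAt (I := 𝓡 n) (ι q)).injective
  have hb (a : Fin n) : MDifferentiableAt (𝓡 n) 𝓘(ℝ, EuclideanSpace ℝ (Fin n))
      (fun r => mvfderiv (𝓡 n) φ r (X a r)) (ι q) :=
    hφs.mdifferentiableAt_mvfderiv_apply (hX.mdifferentiableAt a (ι q))
  have hev (j : Fin m) : ∀ᶠ r in 𝓝 q, mvfderiv (𝓡 m) (φ ∘ ι) r (X' j r) =
      ∑ a, transformMatrix hX X' ι r a j • mvfderiv (𝓡 n) φ (ι r) (X a (ι r)) := by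
    filter_upwards [(hιd q).continuousAt.preimage_mem_nhds
      (extChartAt_source_mem_nhds (I := 𝓡 n) (ι q))] with r hr
    have hφr : MDifferentiableAt (𝓡 n) 𝓘(ℝ, EuclideanSpace ℝ (Fin n)) φ (ι r) :=
      mdifferentiableAt_extChartAt (by simpa using hr)
    have h1 : mvfderiv (𝓡 m) (φ ∘ ι) r (X' j r) =
        mvfderiv (𝓡 n) φ (ι r) (mfderiv (𝓡 m) (𝓡 n) ι r (X' j r)) :=
      mfderiv_comp_apply r hφr (hιd r) _
    rw [h1, ← sum_transformMatrix_smul hX X' ι r j, map_sum]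
    simp only [map_smul]
  have hder (i j : Fin m) : mvfderiv (𝓡 m)
        (fun r => mvfderiv (𝓡 m) (φ ∘ ι) r (X' j r)) q (X' i q) =
      ∑ a, (transformMatrix hX X' ι q a j • ∑ b, transformMatrix hX X' ι q b i •
          mvfderiv (𝓡 n) (fun r => mvfderiv (𝓡 n) φ r (X a r)) (ι q) (X b (ι q)) +
        mvfderiv (𝓡 m) (fun r => transformMatrix hX X' ι r a j) q (X' i q) •
          mvfderiv (𝓡 n) φ (ι q) (X a (ι q))) := by
    have h1 := (hk.mdifferentiableAt_mvfderiv_apply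
      (hX'.mdifferentiableAt j q)).hasDerivAt_comp_chartLine (X' i q)
    have h2 (a : Fin n) := (mdifferentiableAt_transformMatrix hι hX hX'
      a j q).hasDerivAt_comp_chartLine (X' i q)
    have h3 (a : Fin n) : HasDerivAt
        (fun s => mvfderiv (𝓡 n) φ (ι (chartLine q (X' i q) s)) (X a (ι (chartLine q (X' i q) s))))
        (∑ b, transformMatrix hX X' ι q b i •
          mvfderiv (𝓡 n) (fun r => mvfderiv (𝓡 n) φ r (X a r)) (ι q) (X b (ι q))) 0 := by
      have := ((hb a).comp q (hιd q)).hasDerivAt_comp_chartLine (X' i q)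
      refine this.congr_deriv ?_
      have h4 : mvfderiv (𝓡 m) ((fun r => mvfderiv (𝓡 n) φ r (X a r)) ∘ ι) q (X' i q) =
        mvfderiv (𝓡 n) (fun r => mvfderiv (𝓡 n) φ r (X a r)) (ι q)
          (mfderiv (𝓡 m) (𝓡 n) ι q (X' i q)) :=
        mfderiv_comp_apply q (hb a) (hιd q) _
      rw [h4, ← sum_transformMatrix_smul hX X' ι q i, map_sum]
      simp only [map_smul]
    have h5 := HasDerivAt.fun_sum (u := Finset.univ) fun a _ => (h2 a).fun_smul (h3 a)
    have h6 := h5.congr_of_eventuallyEq ((tendsto_chartLine q (X' i q)).eventually (hev j))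
    -- The base point occurs in dependent types, so the substitution at parameter `0` is made in the
    -- whole expression at once.
    have hz (a : Fin n) := congrArg (fun r => mvfderiv (𝓡 n) φ (ι r) (X a (ι r)))
      (chartLine_zero q (X' i q))
    simpa only [hz, chartLine_zero] using h1.unique h6
  apply hinj
  have h1 : mvfderiv (𝓡 n) φ (ι q) (mfderiv (𝓡 m) (𝓡 n) ι q (mlieBracket (𝓡 m) (X' i) (X' j) q)) =
      mvfderiv (𝓡 m) (φ ∘ ι) q (mlieBracket (𝓡 m) (X' i) (X' j) q) :=
    (mfderiv_comp_apply q (hφs.mdifferentiableAt (by simp)) (hιd q) _).symm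
  rw [h1, hk.mvfderiv_mlieBracket (hX'.mdifferentiableAt i q) (hX'.mdifferentiableAt j q),
    hder, hder]
  simp only [map_add, map_sub, map_sum, map_smul,
    hφs.mvfderiv_mlieBracket (hX.mdifferentiableAt _ _) (hX.mdifferentiableAt _ _), smul_sub,
    sub_smul, Finset.sum_add_distrib, Finset.sum_sub_distrib, Finset.smul_sum, smul_smul]
  -- Exchanging the summation indices matches `X_a (X_b φ)` with the iterated derivatives produced
  -- by `hder`.
  rw [Finset.sum_comm (f := fun a b =>
    (transformMatrix hX X' ι q a i * transformMatrix hX X' ι q b j) •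
      mvfderiv (𝓡 n) (fun r => mvfderiv (𝓡 n) φ r (X b r)) (ι q) (X a (ι q)))]
  simp only [mul_comm (transformMatrix hX X' ι q _ j)]
  abel

end Riemannian

end Mechanics

/-! ### Hamel's equations, their quadratic part and the Levi-Civita connection. -/

namespace Mechanics

/-- Contraction with the symmetric `v_j v_k` kills the antisymmetric part. This accounts for the
cancellations both in the Koszul comparison and in the transformation law. -/
theorem sum_sum_mul_add_sub_swap {ι : Type*} [Fintype ι] (v : ι → ℝ) (U W : ι → ι → ℝ) :
    ∑ j, ∑ k, v j * v k * (U j k + (W j k - W k j)) = ∑ j, ∑ k, v j * v k * U j k := by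
  simp only [mul_add, mul_sub, Finset.sum_add_distrib, Finset.sum_sub_distrib]
  rw [Finset.sum_comm (f := fun j k => v j * v k * W k j)]
  simp only [mul_comm (v _) (v _), sub_self, add_zero]

variable {n : ℕ} {Q : Type*} [TopologicalSpace Q]
  [ChartedSpace (EuclideanSpace ℝ (Fin n)) Q]
  [RiemannianBundle (fun q : Q => TangentSpace (𝓡 n) q)]

/-- The part of Hamel's equations that is quadratic in the generalized velocity. -/
def quadraticForce (X : Fin n → (q : Q) → TangentSpace (𝓡 n) q) (q : Q) (v : Fin n → ℝ) :
    Fin n → ℝ :=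
  fun i => ∑ j, ∑ k, v j * v k *
    (mvfderiv (𝓡 n) (fun r => massMatrix X r i j) q (X k q)
      + inner ℝ (VectorField.mlieBracket (𝓡 n) (X i) (X j) q) (X k q)
      - 1 / 2 * mvfderiv (𝓡 n) (fun r => massMatrix X r j k) q (X i q))

theorem momentum_eq_massMatrix_mulVec (X : Fin n → (q : Q) → TangentSpace (𝓡 n) q) (V : Q → ℝ)
    (q : Q) (v : Fin n → ℝ) : momentum X V q v = massMatrix X q *ᵥ v := by
  ext k
  have hd : DifferentiableAt ℝ (lagrangian X V q) v := by
    unfold lagrangian dotProduct Matrix.mulVec dotProduct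
    fun_prop
  have hl : HasDerivAt (fun s : ℝ => v + s • (Pi.single k 1 : Fin n → ℝ)) (Pi.single k 1) 0 := by
    simpa using ((hasDerivAt_id (0 : ℝ)).smul_const (Pi.single k 1 : Fin n → ℝ)).const_add v
  have h1 := HasFDerivAt.comp_hasDerivAt_of_eq 0 hd.hasFDerivAt hl (by simp)
  have hc (i : Fin n) := hasDerivAt_pi.1 hl i
  have h2 := ((HasDerivAt.fun_sum (u := Finset.univ) fun i _ => (hc i).fun_mul
    (HasDerivAt.fun_sum (u := Finset.univ) fun j _ =>
      (hc j).const_mul (massMatrix X q i j))).const_mul (1 / 2 : ℝ)).sub_const (V q)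
  have h3 := h1.unique h2
  rw [momentum, h3]
  simp only [Pi.single_apply, zero_smul, add_zero, mul_ite, mul_one, mul_zero,
    Finset.sum_ite_eq', Finset.mem_univ, if_true, ite_mul, one_mul, zero_mul,
    Finset.sum_add_distrib, Matrix.mulVec, dotProduct]
  simp only [massMatrix_symm X q _ k, mul_comm (v _)]
  ring

variable [IsManifold (𝓡 n) ∞ Q] {X : Fin n → (q : Q) → TangentSpace (𝓡 n) q}

/-- Both sides are `⟨[X_i, X_j], X_k v^k⟩`, expanded in the first and in the second slot. -/
theorem sum_structureCoeff_mul_massMatrix_mulVec (hX : IsFrame X) (q : Q) (v : Fin n → ℝ)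
    (i j : Fin n) :
    ∑ k, structureCoeff hX q k i j * (massMatrix X q *ᵥ v) k =
      ∑ k, v k * inner ℝ (VectorField.mlieBracket (𝓡 n) (X i) (X j) q) (X k q) := by
  trans inner ℝ (VectorField.mlieBracket (𝓡 n) (X i) (X j) q) (velocity X q v)
  · conv_rhs => rw [← hX.sum_coeff_smul q (VectorField.mlieBracket (𝓡 n) (X i) (X j) q)]
    simp only [sum_inner, inner_smul_left, inner_velocity]
    rfl
  · simp only [velocity, Fintype.linearCombination_apply, inner_sum, inner_smul_right]

variable [IsContMDiffRiemannianBundle (𝓡 n) ∞ (EuclideanSpace ℝ (Fin n))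
      (fun q : Q => TangentSpace (𝓡 n) q)]

theorem mvfderiv_lagrangian (hX : IsFrame X) {V : Q → ℝ} {q : Q}
    (hV : MDifferentiableAt (𝓡 n) 𝓘(ℝ, ℝ) V q) (v : Fin n → ℝ) (u : TangentSpace (𝓡 n) q) :
    mvfderiv (𝓡 n) (fun q => lagrangian X V q v) q u =
      1 / 2 * (∑ i, ∑ j, v i * v j * mvfderiv (𝓡 n) (fun r => massMatrix X r i j) q u)
        - mvfderiv (𝓡 n) V q u := by
  have hL : MDifferentiableAt (𝓡 n) 𝓘(ℝ, ℝ) (fun q => lagrangian X V q v) q := by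
    have h1 : MDifferentiableAt (𝓡 n) 𝓘(ℝ, ℝ × (Fin n → Fin n → ℝ))
        (fun r => (V r, fun i j => massMatrix X r i j)) q :=
      hV.prodMk_space (mdifferentiableAt_pi fun i => mdifferentiableAt_pi fun j =>
        hX.mdifferentiableAt_massMatrix i j q)
    have h2 : Differentiable ℝ (fun p : ℝ × (Fin n → Fin n → ℝ) =>
        1 / 2 * (∑ i, v i * ∑ j, p.2 i j * v j) - p.1) := by
      fun_prop
    have h3 : (fun q => lagrangian X V q v) = (fun p : ℝ × (Fin n → Fin n → ℝ) =>
        1 / 2 * (∑ i, v i * ∑ j, p.2 i j * v j) - p.1) ∘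
          fun r => (V r, fun i j => massMatrix X r i j) := rfl
    rw [h3]
    exact DifferentiableAt.comp_mdifferentiableAt (h2 _) h1
  have h3 := hL.hasDerivAt_comp_chartLine u
  have h4 := ((HasDerivAt.fun_sum (u := Finset.univ) fun i _ =>
    (HasDerivAt.fun_sum (u := Finset.univ) fun j _ =>
      ((hX.mdifferentiableAt_massMatrix i j q).hasDerivAt_comp_chartLine u).mul_const
        (v j)).const_mul (v i)).const_mul (1 / 2 : ℝ)).fun_sub (hV.hasDerivAt_comp_chartLine u)
  refine (h3.unique h4).trans ?_
  simp only [Finset.mul_sum]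
  congr 1
  refine Finset.sum_congr rfl fun i _ => Finset.sum_congr rfl fun j _ => ?_
  ring

theorem deriv_momentum (hX : IsFrame X) (V : Q → ℝ) {γ : ℝ → Q} {v : ℝ → Fin n → ℝ} {t : ℝ}
    (hγ : HasGeneralizedVelocityNear X γ v t) (hv : DifferentiableAt ℝ v t) (i : Fin n) :
    deriv (fun s => momentum X V (γ s) (v s) i) t = (massMatrix X (γ t) *ᵥ deriv v t) i +
      ∑ j, ∑ k, v t j * v t k * mvfderiv (𝓡 n) (fun r => massMatrix X r i j) (γ t) (X k (γ t)) := by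
  have h1 (j : Fin n) :=
    (hX.mdifferentiableAt_massMatrix i j (γ t)).hasDerivAt_comp_curve hγ.self_of_nhds
  have h2 (j : Fin n) := hasDerivAt_pi.1 hv.hasDerivAt j
  have h3 := HasDerivAt.fun_sum (u := Finset.univ) fun j _ => (h1 j).fun_mul (h2 j)
  simp only [momentum_eq_massMatrix_mulVec]
  refine (h3.deriv).trans ?_
  rw [Finset.sum_add_distrib, add_comm]
  congr 1
  refine Finset.sum_congr rfl fun j _ => ?_
  rw [velocity, Fintype.linearCombination_apply, map_sum, Finset.sum_mul]
  refine Finset.sum_congr rfl fun k _ => ?_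
  rw [map_smul, smul_eq_mul]
  ring

/-- Separating acceleration and potential reduces correctness of a Coriolis matrix to its action on
`v`. -/
theorem hamelForce_eq (hX : IsFrame X) {V : Q → ℝ} {γ : ℝ → Q} {v : ℝ → Fin n → ℝ} {t : ℝ}
    (hV : MDifferentiableAt (𝓡 n) 𝓘(ℝ, ℝ) V (γ t))
    (hγ : HasGeneralizedVelocityNear X γ v t) (hv : DifferentiableAt ℝ v t) :
    hamelForce hX V γ v t = massMatrix X (γ t) *ᵥ deriv v t + quadraticForce X (γ t) (v t)
      + potentialForce X V (γ t) := by
  ext i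
  have h1 := deriv_momentum hX V hγ hv i
  have h2 := mvfderiv_lagrangian hX hV (v t) (X i (γ t))
  have h3 (j : Fin n) := sum_structureCoeff_mul_massMatrix_mulVec hX (γ t) (v t) i j
  have h4 : ∑ j, ∑ k, structureCoeff hX (γ t) k i j * momentum X V (γ t) (v t) k * v t j =
      ∑ j, ∑ k, v t j * v t k *
        inner ℝ (VectorField.mlieBracket (𝓡 n) (X i) (X j) (γ t)) (X k (γ t)) := by
    refine Finset.sum_congr rfl fun j _ => ?_
    rw [← Finset.sum_mul, momentum_eq_massMatrix_mulVec, h3, Finset.sum_mul]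
    refine Finset.sum_congr rfl fun k _ => ?_
    ring
  have h5 : quadraticForce X (γ t) (v t) i =
      ∑ j, ∑ k, v t j * v t k *
        mvfderiv (𝓡 n) (fun r => massMatrix X r i j) (γ t) (X k (γ t)) +
      ∑ j, ∑ k, v t j * v t k *
        inner ℝ (VectorField.mlieBracket (𝓡 n) (X i) (X j) (γ t)) (X k (γ t)) -
      1 / 2 * ∑ j, ∑ k, v t j * v t k *
        mvfderiv (𝓡 n) (fun r => massMatrix X r j k) (γ t) (X i (γ t)) := by
    simp only [quadraticForce, Finset.mul_sum, ← Finset.sum_add_distrib, ← Finset.sum_sub_distrib]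
    refine Finset.sum_congr rfl fun j _ => Finset.sum_congr rfl fun k _ => ?_
    ring
  rw [hamelForce, h1, h2, h4, Pi.add_apply, Pi.add_apply, h5, potentialForce]
  ring

theorem givesCorrectDynamics_of_mulVec_eq_quadraticForce (hX : IsFrame X) {V : Q → ℝ}
    (hV : MDifferentiable (𝓡 n) 𝓘(ℝ, ℝ) V) {C : CoriolisMatrix n Q}
    (hC : ∀ q v, C q v *ᵥ v = quadraticForce X q v) : GivesCorrectDynamics hX V C := by
  intro γ v t hγ hv
  rw [hamelForce_eq hX (hV _) hγ hv, hC]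

theorem connectionCoriolis_mulVec_eq_quadraticForce (hX : IsFrame X) {D : AffineConnection n Q}
    (hD : IsRiemannianConnection D) (q : Q) (v : Fin n → ℝ) :
    connectionCoriolis X D q v *ᵥ v = quadraticForce X q v := by
  ext i
  have hm (i j k : Fin n) : mvfderiv (𝓡 n) (fun r => massMatrix X r i j) q (X k q) =
      inner ℝ (D (X i) q (X k q)) (X j q) + inner ℝ (X i q) (D (X j) q (X k q)) :=
    hD.2.mvfderiv_inner_eq (X k) (hX.mdifferentiableAt i q) (hX.mdifferentiableAt j q)
  have ht (i j : Fin n) : VectorField.mlieBracket (𝓡 n) (X i) (X j) q =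
      D (X j) q (X i q) - D (X i) q (X j q) :=
    ((CovariantDerivative.torsion_eq_zero_iff D).1 hD.1 (hX.mdifferentiableAt i q)
      (hX.mdifferentiableAt j q)).symm
  have hs : (connectionCoriolis X D q v *ᵥ v) i =
      ∑ j, ∑ k, v j * v k * inner ℝ (X i q) (D (X j) q (X k q)) := by
    simp only [Matrix.mulVec, dotProduct]
    refine Finset.sum_congr rfl fun j _ => ?_
    change inner ℝ (X i q) (D (X j) q (velocity X q v)) * v j = _
    simp only [velocity, Fintype.linearCombination_apply, map_sum, map_smul, inner_sum,
      inner_smul_right, Finset.sum_mul]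
    refine Finset.sum_congr rfl fun k _ => ?_
    ring
  -- With `W_{jk} = ⟨∇_{X_k} X_i, X_j⟩ + ½ ⟨∇_{X_i} X_j, X_k⟩`, the quadratic force has coefficients
  -- `⟨X_i, ∇_{X_k} X_j⟩ + W_{jk} - W_{kj}`.
  rw [hs, ← sum_sum_mul_add_sub_swap v _ fun j k => inner ℝ (D (X i) q (X k q)) (X j q) +
    1 / 2 * inner ℝ (D (X j) q (X i q)) (X k q)]
  refine Finset.sum_congr rfl fun j _ => Finset.sum_congr rfl fun k _ => ?_
  rw [hm, hm, ht, inner_sub_left, real_inner_comm (D (X k) q (X i q)) (X j q)]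
  ring

end Mechanics

/-! ### Transformation of the quadratic force and of motions under the inclusion. -/

namespace Mechanics

/-- How the quadratic part of Hamel's equations transforms, in coefficients: `A` is the transition
matrix with derivatives `dA`, `H` the mass matrix with derivatives `dH`, and `B` the inner products
of brackets of frame fields with frame fields. -/
theorem sum_quadraticForce_coeff_transform {α β : Type*} [Fintype α] [Fintype β]
    (A : α → β → ℝ) (dA : β → α → β → ℝ) (H : α → α → ℝ) (hH : ∀ c d, H c d = H d c)
    (dH B : α → α → α → ℝ) (v : β → ℝ) (i : β) :
    ∑ j, ∑ k, v j * v k *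
      (∑ c, ∑ d, (dA k c i * A d j * H c d + A c i * dA k d j * H c d
          + A c i * A d j * ∑ e, A e k * dH e c d)
        + ((∑ c, ∑ d, (dA i c j - dA j c i) * A d k * H c d)
          + ∑ c, ∑ d, ∑ e, A c i * A d j * A e k * B c d e)
        - 1 / 2 * ∑ c, ∑ d, (dA i c j * A d k * H c d + A c j * dA i d k * H c d
          + A c j * A d k * ∑ e, A e i * dH e c d)) =
    ∑ c, A c i * (∑ d, ∑ e, (∑ j, A d j * v j) * (∑ k, A e k * v k) *
        (dH e c d + B c d e - 1 / 2 * dH c d e))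
      + ∑ c, A c i * ∑ d, H c d * ∑ j, (∑ k, v k * dA k d j) * v j := by
  have hU : ∑ j, ∑ k, v j * v k * (∑ c, A c i * (∑ d, ∑ e, A d j * A e k *
      (dH e c d + B c d e - 1 / 2 * dH c d e)) + ∑ c, A c i * ∑ d, H c d * dA k d j) =
    ∑ c, A c i * (∑ d, ∑ e, (∑ j, A d j * v j) * (∑ k, A e k * v k) *
        (dH e c d + B c d e - 1 / 2 * dH c d e))
      + ∑ c, A c i * ∑ d, H c d * ∑ j, (∑ k, v k * dA k d j) * v j := by
    have hT (T : α → α → α → ℝ) :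
        ∑ j, ∑ k, v j * v k * ∑ c, A c i * ∑ d, ∑ e, A d j * A e k * T c d e =
          ∑ c, A c i * ∑ d, ∑ e, (∑ j, A d j * v j) * (∑ k, A e k * v k) * T c d e := by
      simp only [Finset.mul_sum, Finset.sum_mul]
      rw [Finset.sum_comm_cycle]
      refine Finset.sum_congr rfl fun c _ => ?_
      rw [Finset.sum_comm_cycle]
      refine Finset.sum_congr rfl fun d _ => ?_
      rw [Finset.sum_comm_cycle]
      refine Finset.sum_congr rfl fun e _ => ?_
      rw [Finset.sum_comm]
      refine Finset.sum_congr rfl fun j _ => Finset.sum_congr rfl fun k _ => ?_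
      ring
    have hD : ∑ j, ∑ k, v j * v k * ∑ c, A c i * ∑ d, H c d * dA k d j =
        ∑ c, A c i * ∑ d, H c d * ∑ j, (∑ k, v k * dA k d j) * v j := by
      simp only [Finset.mul_sum, Finset.sum_mul]
      rw [Finset.sum_comm_cycle]
      refine Finset.sum_congr rfl fun c _ => ?_
      rw [Finset.sum_comm_cycle]
      refine Finset.sum_congr rfl fun d _ => Finset.sum_congr rfl fun j _ =>
        Finset.sum_congr rfl fun k _ => ?_
      ring
    rw [← hT, ← hD]
    simp only [mul_add _ (Finset.sum _ _) (Finset.sum _ _), Finset.sum_add_distrib]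
  -- The unwanted derivatives of `A` form `W_{jk} - W_{kj}` for this `W`: its first term comes from
  -- differentiating `A_{ci}` in `H'` and from the bracket, its second from the bracket and the
  -- `½`-term.
  refine Eq.trans ?_ ((sum_sum_mul_add_sub_swap v _ fun j k =>
    (∑ c, ∑ d, dA k c i * A d j * H c d) +
      1 / 2 * ∑ c, ∑ d, dA i c j * A d k * H c d).trans hU)
  refine Finset.sum_congr rfl fun j _ => Finset.sum_congr rfl fun k _ => ?_
  congr 1
  -- Symmetry of `H` makes the two derivatives of `A` in the `½`-term copies of each other with `j`
  -- and `k` exchanged.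
  have h1 : ∑ c, ∑ d, dA i c k * A d j * H c d = ∑ c, ∑ d, A c j * dA i d k * H c d := by
    rw [Finset.sum_comm]
    refine Finset.sum_congr rfl fun c _ => Finset.sum_congr rfl fun d _ => ?_
    rw [hH d c]
    ring
  have h2 : ∑ c, ∑ d, A c j * A d k * ∑ e, A e i * dH e c d =
      ∑ c, A c i * ∑ d, ∑ e, A d j * A e k * dH c d e := by
    simp only [Finset.mul_sum]
    rw [Finset.sum_comm_cycle]
    refine Finset.sum_congr rfl fun c _ => Finset.sum_congr rfl fun d _ =>
      Finset.sum_congr rfl fun e _ => ?_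
    ring
  have h3 : ∑ c, ∑ d, A c i * dA k d j * H c d = ∑ c, A c i * ∑ d, H c d * dA k d j := by
    simp only [Finset.mul_sum]
    refine Finset.sum_congr rfl fun c _ => Finset.sum_congr rfl fun d _ => ?_
    ring
  have h4 : (∑ c, ∑ d, A c i * A d j * ∑ e, A e k * dH e c d) +
      (∑ c, ∑ d, ∑ e, A c i * A d j * A e k * B c d e) -
      1 / 2 * ∑ c, A c i * ∑ d, ∑ e, A d j * A e k * dH c d e =
      ∑ c, A c i * ∑ d, ∑ e, A d j * A e k * (dH e c d + B c d e - 1 / 2 * dH c d e) := by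
    simp only [Finset.mul_sum, ← Finset.sum_add_distrib, ← Finset.sum_sub_distrib]
    refine Finset.sum_congr rfl fun c _ => Finset.sum_congr rfl fun d _ =>
      Finset.sum_congr rfl fun e _ => ?_
    ring
  rw [← h4, ← h3, ← h2, h1]
  simp only [sub_mul, Finset.sum_add_distrib, Finset.sum_sub_distrib]
  ring

variable {n m : ℕ} {Q : Type*} [TopologicalSpace Q]
  [ChartedSpace (EuclideanSpace ℝ (Fin n)) Q] [IsManifold (𝓡 n) ∞ Q]
  [RiemannianBundle (fun q : Q => TangentSpace (𝓡 n) q)]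
  [IsContMDiffRiemannianBundle (𝓡 n) ∞ (EuclideanSpace ℝ (Fin n))
    (fun q : Q => TangentSpace (𝓡 n) q)]
  {Q' : Type*} [TopologicalSpace Q'] [ChartedSpace (EuclideanSpace ℝ (Fin m)) Q']
  [IsManifold (𝓡 m) ∞ Q']
  [RiemannianBundle (fun q : Q' => TangentSpace (𝓡 m) q)]
  [IsContMDiffRiemannianBundle (𝓡 m) ∞ (EuclideanSpace ℝ (Fin m))
    (fun q : Q' => TangentSpace (𝓡 m) q)]
  {X : Fin n → (q : Q) → TangentSpace (𝓡 n) q} {X' : Fin m → (q : Q') → TangentSpace (𝓡 m) q}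
  {ι : Q' → Q}

omit [IsManifold (𝓡 m) ∞ Q'] [IsContMDiffRiemannianBundle (𝓡 n) ∞ (EuclideanSpace ℝ (Fin n))
    (fun q : Q => TangentSpace (𝓡 n) q)] [IsContMDiffRiemannianBundle (𝓡 m) ∞
    (EuclideanSpace ℝ (Fin m)) (fun q : Q' => TangentSpace (𝓡 m) q)] in
theorem massMatrix_induced (hX : IsFrame X)
    (hmetric : ∀ (q : Q') (u w : TangentSpace (𝓡 m) q),
      inner ℝ (mfderiv (𝓡 m) (𝓡 n) ι q u) (mfderiv (𝓡 m) (𝓡 n) ι q w) = inner ℝ u w)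
    (q : Q') (i j : Fin m) :
    massMatrix X' q i j = ∑ c, ∑ d, transformMatrix hX X' ι q c i * transformMatrix hX X' ι q d j *
      massMatrix X (ι q) c d := by
  trans inner ℝ (X' i q) (X' j q)
  · rfl
  rw [← hmetric, ← sum_transformMatrix_smul hX X' ι q i, ← sum_transformMatrix_smul hX X' ι q j]
  rw [sum_inner]
  refine Finset.sum_congr rfl fun c _ => ?_
  rw [inner_sum]
  refine Finset.sum_congr rfl fun d _ => ?_
  rw [real_inner_smul_left, real_inner_smul_right, mul_assoc]
  rfl

theorem mvfderiv_massMatrix_induced (hι : ContMDiff (𝓡 m) (𝓡 n) ∞ ι)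
    (hmetric : ∀ (q : Q') (u w : TangentSpace (𝓡 m) q),
      inner ℝ (mfderiv (𝓡 m) (𝓡 n) ι q u) (mfderiv (𝓡 m) (𝓡 n) ι q w) = inner ℝ u w)
    (hX : IsFrame X) (hX' : IsFrame X') (q : Q') (i j k : Fin m) :
    mvfderiv (𝓡 m) (fun r => massMatrix X' r i j) q (X' k q) =
      ∑ c, ∑ d, (mvfderiv (𝓡 m) (fun r => transformMatrix hX X' ι r c i) q (X' k q) *
          transformMatrix hX X' ι q d j * massMatrix X (ι q) c d
        + transformMatrix hX X' ι q c i *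
          mvfderiv (𝓡 m) (fun r => transformMatrix hX X' ι r d j) q (X' k q) *
          massMatrix X (ι q) c d
        + transformMatrix hX X' ι q c i * transformMatrix hX X' ι q d j *
          ∑ e, transformMatrix hX X' ι q e k *
            mvfderiv (𝓡 n) (fun r => massMatrix X r c d) (ι q) (X e (ι q))) := by
  have hA (c : Fin n) (i : Fin m) := (mdifferentiableAt_transformMatrix hι hX hX'
      c i q).hasDerivAt_comp_chartLine (X' k q)
  have hιq : MDifferentiableAt (𝓡 m) (𝓡 n) ι q := (hι.mdifferentiable (by simp)) q
  have hH (c d : Fin n) : HasDerivAt (fun s => massMatrix X (ι (chartLine q (X' k q) s)) c d)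
      (∑ e, transformMatrix hX X' ι q e k *
        mvfderiv (𝓡 n) (fun r => massMatrix X r c d) (ι q) (X e (ι q))) 0 := by
    have h := hX.mdifferentiableAt_massMatrix c d (ι q)
    refine ((h.comp q hιq).hasDerivAt_comp_chartLine (X' k q)).congr_deriv ?_
    refine (mvfderiv_comp_apply q h hιq _).trans ?_
    rw [← sum_transformMatrix_smul hX X' ι q k, map_sum]
    simp only [map_smul, smul_eq_mul]
  have h1 := HasDerivAt.fun_sum (u := Finset.univ) fun c _ =>
    HasDerivAt.fun_sum (u := Finset.univ) fun d _ =>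
      ((hA c i).fun_mul (hA d j)).fun_mul (hH c d)
  have h2 := (hX'.mdifferentiableAt_massMatrix i j q).hasDerivAt_comp_chartLine (X' k q)
  simp only [massMatrix_induced hX hmetric] at h2 ⊢
  refine (h2.unique h1).trans ?_
  simp only [chartLine_zero, add_mul]

omit [IsContMDiffRiemannianBundle (𝓡 m) ∞ (EuclideanSpace ℝ (Fin m))
    (fun q : Q' => TangentSpace (𝓡 m) q)] in
theorem inner_mlieBracket_induced (hι : ContMDiff (𝓡 m) (𝓡 n) ∞ ι)
    (hmetric : ∀ (q : Q') (u w : TangentSpace (𝓡 m) q),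
      inner ℝ (mfderiv (𝓡 m) (𝓡 n) ι q u) (mfderiv (𝓡 m) (𝓡 n) ι q w) = inner ℝ u w)
    (hX : IsFrame X) (hX' : IsFrame X') (q : Q') (i j k : Fin m) :
    inner ℝ (VectorField.mlieBracket (𝓡 m) (X' i) (X' j) q) (X' k q) =
      (∑ c, ∑ d, (mvfderiv (𝓡 m) (fun r => transformMatrix hX X' ι r c j) q (X' i q)
          - mvfderiv (𝓡 m) (fun r => transformMatrix hX X' ι r c i) q (X' j q)) *
          transformMatrix hX X' ι q d k * massMatrix X (ι q) c d)
        + ∑ c, ∑ d, ∑ e, transformMatrix hX X' ι q c i * transformMatrix hX X' ι q d j *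
          transformMatrix hX X' ι q e k *
          inner ℝ (VectorField.mlieBracket (𝓡 n) (X c) (X d) (ι q)) (X e (ι q)) := by
  rw [← hmetric, mfderiv_mlieBracket_frame hι hX hX', ← sum_transformMatrix_smul hX X' ι q k]
  rw [inner_add_left]
  congr 1
  · rw [sum_inner]
    refine Finset.sum_congr rfl fun c _ => ?_
    rw [inner_sum]
    refine Finset.sum_congr rfl fun d _ => ?_
    rw [real_inner_smul_left, real_inner_smul_right, mul_assoc]
    rfl
  · rw [sum_inner]
    refine Finset.sum_congr rfl fun c _ => ?_
    rw [sum_inner]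
    refine Finset.sum_congr rfl fun d _ => ?_
    rw [inner_sum]
    refine Finset.sum_congr rfl fun e _ => ?_
    rw [real_inner_smul_left, real_inner_smul_right, ← mul_assoc]

theorem quadraticForce_induced (hι : ContMDiff (𝓡 m) (𝓡 n) ∞ ι)
    (hmetric : ∀ (q : Q') (u w : TangentSpace (𝓡 m) q),
      inner ℝ (mfderiv (𝓡 m) (𝓡 n) ι q u) (mfderiv (𝓡 m) (𝓡 n) ι q w) = inner ℝ u w)
    (hX : IsFrame X) (hX' : IsFrame X') (q : Q') (v : Fin m → ℝ) :
    quadraticForce X' q v =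
      (transformMatrix hX X' ι q)ᵀ *ᵥ quadraticForce X (ι q) (transformMatrix hX X' ι q *ᵥ v) +
      ((transformMatrix hX X' ι q)ᵀ * massMatrix X (ι q) * transformMatrixDot hX X' ι q v) *ᵥ v := by
  ext i
  simp only [quadraticForce, mvfderiv_massMatrix_induced hι hmetric hX hX',
    inner_mlieBracket_induced hι hmetric hX hX', Pi.add_apply]
  rw [← Matrix.mulVec_mulVec, ← Matrix.mulVec_mulVec]
  exact sum_quadraticForce_coeff_transform (transformMatrix hX X' ι q)
    (fun k c i => mvfderiv (𝓡 m) (fun r => transformMatrix hX X' ι r c i) q (X' k q))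
    (massMatrix X (ι q)) (massMatrix_symm X (ι q))
    (fun e c d => mvfderiv (𝓡 n) (fun r => massMatrix X r c d) (ι q) (X e (ι q)))
    (fun c d e => inner ℝ (VectorField.mlieBracket (𝓡 n) (X c) (X d) (ι q)) (X e (ι q))) v i

/-- The assumption on `C` concerns a single point and velocity, so it can be used at one instant of
one motion. -/
theorem inducedCoriolis_mulVec_eq_quadraticForce (hι : ContMDiff (𝓡 m) (𝓡 n) ∞ ι)
    (hmetric : ∀ (q : Q') (u w : TangentSpace (𝓡 m) q),
      inner ℝ (mfderiv (𝓡 m) (𝓡 n) ι q u) (mfderiv (𝓡 m) (𝓡 n) ι q w) = inner ℝ u w)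
    (hX : IsFrame X) (hX' : IsFrame X') {C : CoriolisMatrix n Q} {q : Q'} {v : Fin m → ℝ}
    (hC : C (ι q) (transformMatrix hX X' ι q *ᵥ v) *ᵥ (transformMatrix hX X' ι q *ᵥ v) =
      quadraticForce X (ι q) (transformMatrix hX X' ι q *ᵥ v)) :
    inducedCoriolis hX X' ι C q v *ᵥ v = quadraticForce X' q v := by
  rw [quadraticForce_induced hι hmetric hX hX', ← hC, Matrix.mulVec_mulVec, Matrix.mulVec_mulVec,
    ← Matrix.add_mulVec]
  rfl

omit [IsManifold (𝓡 m) ∞ Q'] [RiemannianBundle (fun q : Q' => TangentSpace (𝓡 m) q)]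
    [IsContMDiffRiemannianBundle (𝓡 m) ∞ (EuclideanSpace ℝ (Fin m))
      (fun q : Q' => TangentSpace (𝓡 m) q)]
    [RiemannianBundle (fun q : Q => TangentSpace (𝓡 n) q)]
    [IsContMDiffRiemannianBundle (𝓡 n) ∞ (EuclideanSpace ℝ (Fin n))
      (fun q : Q => TangentSpace (𝓡 n) q)] in
theorem HasGeneralizedVelocityNear.comp_inclusion (hι : ContMDiff (𝓡 m) (𝓡 n) ∞ ι) (hX : IsFrame X)
    {γ : ℝ → Q'} {v : ℝ → Fin m → ℝ} {t : ℝ} (hγ : HasGeneralizedVelocityNear X' γ v t) :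
    HasGeneralizedVelocityNear X (ι ∘ γ) (fun s => transformMatrix hX X' ι (γ s) *ᵥ v s) t := by
  filter_upwards [hγ] with s hs
  have h1 := ((hι.mdifferentiable (by simp)) (γ s)).hasMFDerivAt.comp s hs
  refine h1.congr_mfderiv ?_
  ext
  simp only [Function.comp_apply, velocity_transformMatrix_mulVec]
  exact map_smul (mfderiv (𝓡 m) (𝓡 n) ι (γ s)) _ _

omit [RiemannianBundle (fun q : Q' => TangentSpace (𝓡 m) q)]
    [IsContMDiffRiemannianBundle (𝓡 m) ∞ (EuclideanSpace ℝ (Fin m))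
      (fun q : Q' => TangentSpace (𝓡 m) q)] in
theorem differentiableAt_transformMatrix_mulVec (hι : ContMDiff (𝓡 m) (𝓡 n) ∞ ι) (hX : IsFrame X)
    (hX' : IsFrame X') {γ : ℝ → Q'} {v : ℝ → Fin m → ℝ} {t : ℝ}
    (hγ : HasGeneralizedVelocityNear X' γ v t) (hv : DifferentiableAt ℝ v t) :
    DifferentiableAt ℝ (fun s => transformMatrix hX X' ι (γ s) *ᵥ v s) t := by
  refine differentiableAt_pi.2 fun i => ?_
  have h := HasDerivAt.fun_sum (u := Finset.univ) fun j _ =>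
    ((mdifferentiableAt_transformMatrix hι hX hX' i j (γ t)).hasDerivAt_comp_curve
      hγ.self_of_nhds).fun_mul (hasDerivAt_pi.1 hv.hasDerivAt j)
  exact h.differentiableAt

end Mechanics

end

theorem mainTheorem9 {n m : ℕ}
    {Q : Type*} [TopologicalSpace Q] [ChartedSpace (EuclideanSpace ℝ (Fin n)) Q]
    [IsManifold (𝓡 n) ∞ Q]
    [Bundle.RiemannianBundle (fun q : Q => TangentSpace (𝓡 n) q)]
    [IsContMDiffRiemannianBundle (𝓡 n) ∞ (EuclideanSpace ℝ (Fin n))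
      (fun q : Q => TangentSpace (𝓡 n) q)]
    {Q' : Type*} [TopologicalSpace Q'] [ChartedSpace (EuclideanSpace ℝ (Fin m)) Q']
    [IsManifold (𝓡 m) ∞ Q']
    [Bundle.RiemannianBundle (fun q : Q' => TangentSpace (𝓡 m) q)]
    [IsContMDiffRiemannianBundle (𝓡 m) ∞ (EuclideanSpace ℝ (Fin m))
      (fun q : Q' => TangentSpace (𝓡 m) q)]
    -- the inclusion of the submanifold `Q'`, which carries the metric induced from `Q`
    (ι : Q' → Q) (hι : ContMDiff (𝓡 m) (𝓡 n) ∞ ι)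
    (hmetric : ∀ (q : Q') (u w : TangentSpace (𝓡 m) q),
      inner ℝ (mfderiv (𝓡 m) (𝓡 n) ι q u) (mfderiv (𝓡 m) (𝓡 n) ι q w) = inner ℝ u w)
    -- the frames that define the generalized velocities, and the potential energy
    (X : Fin n → (q : Q) → TangentSpace (𝓡 n) q) (hX : Mechanics.IsFrame X)
    (X' : Fin m → (q : Q') → TangentSpace (𝓡 m) q) (hX' : Mechanics.IsFrame X')
    (V : Q → ℝ) (hV : ContMDiff (𝓡 n) 𝓘(ℝ, ℝ) ∞ V)
    (C : Mechanics.CoriolisMatrix n Q) :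
    (Mechanics.GivesCorrectDynamics hX V C →
      Mechanics.GivesCorrectDynamics hX' (V ∘ ι) (Mechanics.inducedCoriolis hX X' ι C)) ∧
    (∀ (D : Mechanics.AffineConnection n Q) (D' : Mechanics.AffineConnection m Q'),
      Mechanics.IsRiemannianConnection D → Mechanics.IsRiemannianConnection D' →
      (∀ (q : Q) (v : Fin n → ℝ),
        C q v *ᵥ v = Mechanics.connectionCoriolis X D q v *ᵥ v) →
      (∀ (q : Q') (v' : Fin m → ℝ),
        Mechanics.inducedCoriolis hX X' ι C q v' *ᵥ v'
          = Mechanics.connectionCoriolis X' D' q v' *ᵥ v') ∧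
      Mechanics.GivesCorrectDynamics hX' (V ∘ ι) (Mechanics.inducedCoriolis hX X' ι C)) := by
  have hVd : MDifferentiable (𝓡 n) 𝓘(ℝ, ℝ) V := hV.mdifferentiable (by simp)
  have hVιd : MDifferentiable (𝓡 m) 𝓘(ℝ, ℝ) (V ∘ ι) := (hV.comp hι).mdifferentiable (by simp)
  refine ⟨fun hC γ v t hγ hv => ?_, fun D D' hD hD' hC => ?_⟩
  · have hw := Mechanics.differentiableAt_transformMatrix_mulVec hι hX hX' hγ hv
    have hγι := hγ.comp_inclusion hι hX
    -- The motion on `Q'` is itself a motion on `Q`, with velocity `A v`. Cancelling its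
    -- acceleration and potential terms leaves `C v = F` exactly where it is needed, so no motion
    -- through a prescribed state has to be constructed.
    have h := hC _ _ t hγι hw
    rw [Mechanics.hamelForce_eq hX (hVd _) hγι hw, add_left_inj, add_right_inj] at h
    rw [Mechanics.hamelForce_eq hX' (hVιd _) hγ hv,
      Mechanics.inducedCoriolis_mulVec_eq_quadraticForce hι hmetric hX hX' h]
  · have hind (q : Q') (v : Fin m → ℝ) : Mechanics.inducedCoriolis hX X' ι C q v *ᵥ v =
        Mechanics.quadraticForce X' q v :=
      Mechanics.inducedCoriolis_mulVec_eq_quadraticForce hι hmetric hX hX'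
        ((hC _ _).trans (Mechanics.connectionCoriolis_mulVec_eq_quadraticForce hX hD _ _))
    exact ⟨fun q v => (hind q v).trans
        (Mechanics.connectionCoriolis_mulVec_eq_quadraticForce hX' hD' q v).symm,
      Mechanics.givesCorrectDynamics_of_mulVec_eq_quadraticForce hX' hVιd hind⟩
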